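/- For every $n$ let $N=N(n)\ge 1$ be an integer, and put $n$ indistinguishable balls into $N$ distinguishable boxes so that all distributions are equally likely: if $\xi_i=\xi_i^{(n)}$ denotes the number of balls in box $i$, then $$\mathbb P(\xi_1=i_1,\ldots,\xi_N=i_N)=\binom{n+N-1}{n}^{-1}$$ for all integers $i_1,\ldots,i_N\ge 0$ with $i_1+\cdots+i_N=n$. For a fixed integer $r\ge 0$ let $S_n^{(r)}=\sum_{i=1}^N I(\xi_i=r)$ be the number of boxes containing exactly $r$ balls. Suppose that $N/n\to\lambda\in(0,\infty]$ as $n\to\infty$, and that either (a) $r\ge 0$ and $\lambda<\infty$, or (b) $r\ge 2$, $\lambda=\infty$ and $n^r/N^{r-1}\to\infty$. Then, as $n\to\infty$, $$\frac{S_n^{(r)}-\mathbb E\,S_n^{(r)}}{\sqrt{n^r/N^{r-1}}}\stackrel{d}{\to}\mathcal N(0,\sigma_r^2),$$ where $$\sigma_r^2=\left(\frac{\lambda}{1+\lambda}\right)^{r+1}\left(1-\frac{\lambda\left(1+\lambda+(\lambda r-1)^2\right)}{(1+\lambda)^{r+2}}\right)\quad\text{if }\lambda<\infty,\qquad \sigma_r^2=1\quad\text{if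 }\lambda=\infty.$$ -/

import Mathlib

open MeasureTheory ProbabilityTheory Filter Topology
open scoped ENNReal

/-- The law of the occupancy vector `(ξ₁, …, ξ_N)` when `n` indistinguishable balls are put into
`N` distinguishable boxes: the uniform distribution on the set of all
`k : Fin N → ℕ` with `k₁ + ⋯ + k_N = n`. -/
noncomputable def indistinguishableBallsLaw (n N : ℕ) : Measure (Fin N → ℕ) :=
  uniformOn {k | ∑ i, k i = n}

/-- The number of boxes that contain exactly `r` balls under the occupancy vector `k`. -/
def boxesWithExactly {N : ℕ} (r : ℕ) (k : Fin N → ℕ) : ℕ :=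
  ∑ i, if k i = r then 1 else 0

/-- The normalization `n ^ r / N ^ (r - 1)`; the exponent `r - 1` is an integer, so that
for `r = 0` this is `N` when `N` is positive. -/
noncomputable def occupancyScale (r n N : ℕ) : ℝ :=
  (n : ℝ) ^ r / (N : ℝ) ^ ((r : ℤ) - 1)

/-- The asymptotic variance for finite `lam`. -/
noncomputable def occupancySigmaSqFinite (r : ℕ) (lam : ℝ) : ℝ :=
  (lam / (1 + lam)) ^ (r + 1) *
    (1 - lam * (1 + lam + (lam * r - 1) ^ 2) / (1 + lam) ^ (r + 2))

/-- The asymptotic variance for `lam ∈ (0, ∞]`, equal to `1` for `lam = ∞`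
(only used there for `r ≥ 2`). -/
noncomputable def occupancySigmaSq (r : ℕ) (lam : ℝ≥0∞) : ℝ :=
  if lam = ∞ then 1 else occupancySigmaSqFinite r lam.toReal

theorem occupancySigmaSqFinite_pos (r : ℕ) {lam : ℝ} (h : 0 < lam) :
    0 < occupancySigmaSqFinite r lam := by
  have key : ∀ r : ℕ, 1 + ((r : ℝ) + 2) * lam + (r + 2) * (r + 1) / 2 * lam ^ 2
      + (r + 2) * (r + 1) * r / 6 * lam ^ 3 ≤ (1 + lam) ^ (r + 2) := by
    intro r
    induction r with
    | zero => norm_num; nlinarith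
    | succ r ih =>
      have h1 := mul_le_mul_of_nonneg_right ih (by linarith : (0 : ℝ) ≤ 1 + lam)
      have h2 : (0 : ℝ) ≤ (r + 2) * (r + 1) * r / 6 * lam ^ 4 := by positivity
      rw [show r + 1 + 2 = (r + 2) + 1 by ring, pow_succ (1 + lam)]
      push_cast
      nlinarith
  have hr : (0 : ℝ) ≤ r * ((r - 1) * (r - 2)) := by
    rcases r with _ | _ | r
    · simp
    · simp
    · push_cast
      have : (0 : ℝ) ≤ r := by positivity
      have e : ((r : ℝ) + 1 + 1 - 1) * (r + 1 + 1 - 2) = (r + 1) * r := by ring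
      rw [e]; positivity
  have hlt : lam * (1 + lam + (lam * r - 1) ^ 2) < (1 + lam) ^ (r + 2) := by
    refine lt_of_lt_of_le ?_ (key r)
    have h3 := mul_nonneg hr (pow_pos h 3).le
    have h4 : (0 : ℝ) ≤ r * lam := by positivity
    have h5 : (0 : ℝ) ≤ (r : ℝ) ^ 2 * lam ^ 2 := by positivity
    have h6 : (0 : ℝ) ≤ (r : ℝ) * lam ^ 2 := by positivity
    nlinarith
  unfold occupancySigmaSqFinite
  have hp : 0 < (1 + lam) ^ (r + 2) := by positivity
  have := (div_lt_one hp).2 hlt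
  exact mul_pos (by positivity) (by linarith)

theorem occupancySigmaSq_pos (r : ℕ) {lam : ℝ≥0∞} (h : 0 < lam) :
    0 < occupancySigmaSq r lam := by
  unfold occupancySigmaSq
  split_ifs with hl
  · exact one_pos
  · exact occupancySigmaSqFinite_pos r (ENNReal.toReal_pos h.ne' hl)

/-! The uniform law on occupancy vectors is the law of `N` independent geometric variables
conditioned on their sum being `n`, since every vector of sum `n` has the same mass `(1 - p) ^ n * p
^ N`. Choose `p = N / (N + n)`, so that the unconditioned sum has mean `n`. Let `ψ(t, u)` be the
characteristic function of the centred pair (indicator of `k = r`, `k`). Orthogonality of characters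
writes the characteristic function of the count, centred at `N * (1 - p) ^ r * p`, as the quotient
of the integrals of `ψ(t, u) ^ N` and `ψ(0, u) ^ N` over `[-π, π]`
(`integral_cexp_boxesWithExactly`).

Let `B` be the scale and `V` the variance of the sum, and put `t = s / √B`, `u = v / √V`. A Taylor
expansion with third-moment remainder gives `ψ ^ N → exp (-((v + s D) ^ 2 + s ^ 2 σ ^ 2) / 2)`
(`tendsto_geomCharFun_pow`). Two adjacent values other than `r` have relative phase `u` whatever `t`
is, which gives a Gaussian majorant (`eventually_norm_geomCharFun_pow_le`). By dominated convergence
the integrals converge; integrating out `v` removes `D`, and the quotient tends to `exp (-σ ^ 2 s ^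
2 / 2)`. The loss `D ^ 2` in the variance is the effect of conditioning.

The exact mean differs from `N * (1 - p) ^ r * p` by a relative error `O(1 / n)`, negligible against
`√B` because `B = O(n)` (`tendsto_centering`). -/

/-! ### Moments of the geometric distribution -/

section Geometric

variable {p : unitInterval}

lemma norm_one_sub_lt_one_of_ne_zero (hp : p ≠ 0) : ‖(1 - p : ℝ)‖ < 1 := by
  have h0 : 0 < (p : ℝ) := unitInterval.pos_iff_ne_zero.2 hp
  have h1 := p.2.2
  rw [Real.norm_eq_abs, abs_lt]
  constructor <;> linarith

lemma integrable_geometricMeasure_pow (hp : p ≠ 0) (j : ℕ) :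
    Integrable (fun k : ℕ => (k : ℝ) ^ j) (geometricMeasure p) := by
  rw [integrable_geometricMeasure_iff hp]
  refine ((summable_pow_mul_geometric_of_norm_lt_one j
    (norm_one_sub_lt_one_of_ne_zero hp)).mul_left (p : ℝ)).congr fun k => ?_
  rw [Real.norm_of_nonneg (by positivity)]
  ring

lemma integrable_geometricMeasure_natCast (hp : p ≠ 0) :
    Integrable (fun k : ℕ => (k : ℝ)) (geometricMeasure p) := by
  simpa using integrable_geometricMeasure_pow hp 1

lemma integral_geometricMeasure_natCast (hp : p ≠ 0) :
    ∫ k, (k : ℝ) ∂geometricMeasure p = (1 - p) / p := by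
  have h0 : (p : ℝ) ≠ 0 := by simpa using hp
  rw [integral_geometricMeasure hp]
  refine HasSum.tsum_eq ?_
  convert! (hasSum_coe_mul_geometric_of_norm_lt_one
    (norm_one_sub_lt_one_of_ne_zero hp)).mul_left (p : ℝ) using 1
  · ext k; simp; ring
  · rw [sub_sub_cancel]; field_simp

lemma integral_geometricMeasure_sq (hp : p ≠ 0) :
    ∫ k, (k : ℝ) ^ 2 ∂geometricMeasure p = (1 - p) * (2 - p) / p ^ 2 := by
  have h0 : (p : ℝ) ≠ 0 := by simpa using hp
  have hq := norm_one_sub_lt_one_of_ne_zero hp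
  rw [integral_geometricMeasure hp]
  refine HasSum.tsum_eq ?_
  -- This is `k ^ 2 = 2 * (k + 2).choose 2 - 3 * k - 2`.
  convert! ((((hasSum_choose_mul_geometric_of_norm_lt_one 2 hq).mul_left 2).sub
    ((hasSum_coe_mul_geometric_of_norm_lt_one hq).mul_left 3)).sub
    ((hasSum_geometric_of_norm_lt_one hq).mul_left 2)).mul_left (p : ℝ) using 1
  · ext k
    rw [Nat.cast_choose_two]
    push_cast
    simp only [smul_eq_mul]
    ring
  · rw [sub_sub_cancel]; field_simp; ring

/-- Dropping the zero term leaves `(b + 1) ^ 3 ≤ 6 * (b + 3).choose 3`. The factor `1 - p` must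
survive, since `p → 1` when `lam = ∞`. -/
lemma integral_geometricMeasure_cube_le (hp : p ≠ 0) :
    ∫ k, (k : ℝ) ^ 3 ∂geometricMeasure p ≤ 6 * (1 - p) / p ^ 3 := by
  have h0 : 0 < (p : ℝ) := unitInterval.pos_iff_ne_zero.2 hp
  have hq := norm_one_sub_lt_one_of_ne_zero hp
  have hq0 : 0 ≤ (1 - p : ℝ) := by linarith [p.2.2]
  have hs := hasSum_integral_geometricMeasure hp (integrable_geometricMeasure_pow hp 3)
  rw [← hs.tsum_eq, hs.summable.tsum_eq_zero_add]
  have hs3 := (hasSum_choose_mul_geometric_of_norm_lt_one 3 hq).mul_left (6 * (1 - p) * p : ℝ)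
  have hle : ∑' b : ℕ, ((1 - p : ℝ) ^ (b + 1) * p) • ((b + 1 : ℕ) : ℝ) ^ 3 ≤
      6 * (1 - p) * p * (1 / (1 - (1 - p)) ^ (3 + 1)) := by
    refine hasSum_le (fun b => ?_) ((summable_nat_add_iff 1).2 hs.summable).hasSum hs3
    have hc : ((b + 1 : ℕ) : ℝ) ^ 3 ≤ 6 * ((b + 3).choose 3 : ℝ) := by
      have := Nat.pow_succ_le_ascFactorial (b + 1) 3
      rw [Nat.ascFactorial_eq_factorial_mul_choose] at this
      exact_mod_cast this
    have := mul_le_mul_of_nonneg_left hc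
      (mul_nonneg (pow_nonneg hq0 (b + 1)) h0.le)
    rw [smul_eq_mul]
    calc _ ≤ _ := this
      _ = _ := by ring
  refine le_trans (by simpa using hle) (le_of_eq ?_)
  field_simp

/-- The centred linear combination `t (1{k = r} - P(k = r)) + u (k - E k)` for the geometric
distribution. -/
noncomputable def geomCentred (p : unitInterval) (r : ℕ) (t u : ℝ) (k : ℕ) : ℝ :=
  t * ((if k = r then 1 else 0) - (1 - p) ^ r * p) + u * (k - (1 - p) / p)

lemma integrable_ite_geometricMeasure (r : ℕ) :
    Integrable (fun k : ℕ => if k = r then (1 : ℝ) else 0) (geometricMeasure p) :=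
  Integrable.of_bound (C := 1) (by fun_prop) (.of_forall fun k => by split_ifs <;> simp)

lemma integral_ite_geometricMeasure (hp : p ≠ 0) (r : ℕ) :
    ∫ k, (if k = r then (1 : ℝ) else 0) ∂geometricMeasure p = (1 - p) ^ r * p := by
  rw [integral_geometricMeasure hp, tsum_eq_single r (by simp +contextual)]
  simp

lemma integrable_geomCentred (hp : p ≠ 0) (r : ℕ) (t u : ℝ) :
    Integrable (geomCentred p r t u) (geometricMeasure p) :=
  (((integrable_ite_geometricMeasure r).sub (integrable_const _)).const_mul t).add
    (((integrable_geometricMeasure_natCast hp).sub (integrable_const _)).const_mul u)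

lemma integral_geomCentred (hp : p ≠ 0) (r : ℕ) (t u : ℝ) :
    ∫ k, geomCentred p r t u k ∂geometricMeasure p = 0 := by
  have h1 := integrable_ite_geometricMeasure (p := p) r
  have h2 := integrable_geometricMeasure_natCast hp
  have h3 : Integrable (fun k : ℕ => (if k = r then (1 : ℝ) else 0) - (1 - p) ^ r * p)
    (geometricMeasure p) := h1.sub (integrable_const _)
  have h4 : Integrable (fun k : ℕ => (k : ℝ) - (1 - p) / p) (geometricMeasure p) :=
    h2.sub (integrable_const _)
  unfold geomCentred
  rw [integral_add (h3.const_mul t) (h4.const_mul u), integral_const_mul, integral_const_mul,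
    integral_sub h1 (integrable_const _), integral_sub h2 (integrable_const _),
    integral_ite_geometricMeasure hp, integral_geometricMeasure_natCast hp]
  simp

/-- The indicator is idempotent and `k` times it is `r` times it, so the square is linear in the
indicator, `k ^ 2`, `k` and `1`. -/
lemma geomCentred_sq (r : ℕ) (t u : ℝ) (k : ℕ) :
    geomCentred p r t u k ^ 2 =
      (t ^ 2 * (1 - 2 * ((1 - p) ^ r * p)) + 2 * t * u * (r - (1 - p) / p))
          * (if k = r then 1 else 0)
        + (u ^ 2 * (k : ℝ) ^ 2
        + ((- 2 * t * u * ((1 - p) ^ r * p) - 2 * u ^ 2 * ((1 - p) / p)) * k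
        + (t ^ 2 * ((1 - p) ^ r * p) ^ 2 + 2 * t * u * ((1 - p) ^ r * p) * ((1 - p) / p)
            + u ^ 2 * ((1 - p) / p) ^ 2))) := by
  unfold geomCentred
  split_ifs with h
  · subst h; ring
  · ring

lemma integrable_geomCentred_sq (hp : p ≠ 0) (r : ℕ) (t u : ℝ) :
    Integrable (fun k => geomCentred p r t u k ^ 2) (geometricMeasure p) := by
  simp_rw [geomCentred_sq]
  exact ((integrable_ite_geometricMeasure r).const_mul _).add
    (((integrable_geometricMeasure_pow hp 2).const_mul _).add
      (((integrable_geometricMeasure_natCast hp).const_mul _).add (integrable_const _)))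

lemma integral_geomCentred_sq (hp : p ≠ 0) (r : ℕ) (t u : ℝ) :
    ∫ k, geomCentred p r t u k ^ 2 ∂geometricMeasure p =
      t ^ 2 * ((1 - p) ^ r * p) * (1 - (1 - p) ^ r * p)
        + 2 * t * u * ((1 - p) ^ r * p) * (r - (1 - p) / p) + u ^ 2 * ((1 - p) / p ^ 2) := by
  have h0 : (p : ℝ) ≠ 0 := by simpa using hp
  have h1 := integrable_ite_geometricMeasure (p := p) r
  have h2 := integrable_geometricMeasure_natCast hp
  have h3 := integrable_geometricMeasure_pow hp 2
  have hc (c : ℝ) := integrable_const (μ := geometricMeasure p) c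
  simp_rw [geomCentred_sq]
  rw [integral_add (h1.const_mul _) ((h3.const_mul _).fun_add ((h2.const_mul _).fun_add (hc _))),
    integral_add (h3.const_mul _) ((h2.const_mul _).fun_add (hc _)),
    integral_add (h2.const_mul _) (hc _), integral_const_mul, integral_const_mul,
    integral_const_mul, integral_ite_geometricMeasure hp, integral_geometricMeasure_natCast hp,
    integral_geometricMeasure_sq hp]
  simp only [integral_const, probReal_univ, one_smul]
  field_simp
  ring

lemma abs_add_pow_three_le (a b : ℝ) : |a + b| ^ 3 ≤ 4 * (|a| ^ 3 + |b| ^ 3) := by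
  have h := pow_le_pow_left₀ (abs_nonneg _) (abs_add_le a b) 3
  have ha := abs_nonneg a
  have hb := abs_nonneg b
  -- For `a, b ≥ 0`, `4 * (a ^ 3 + b ^ 3) - (a + b) ^ 3 = 3 * (a + b) * (a - b) ^ 2`.
  nlinarith [mul_nonneg (add_nonneg ha hb) (sq_nonneg (|a| - |b|))]

lemma abs_geomCentred_cube_le (hp : p ≠ 0) (r : ℕ) (t u : ℝ) (k : ℕ) :
    |geomCentred p r t u k| ^ 3 ≤
      4 * |t| ^ 3 * ((if k = r then 1 else 0) + (1 - p) ^ r * p)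
        + (4 * |u| ^ 3 * (k : ℝ) ^ 3 + 4 * |u| ^ 3 * ((1 - p) / p) ^ 3) := by
  have h0 : 0 < (p : ℝ) := unitInterval.pos_iff_ne_zero.2 hp
  have hq0 : 0 ≤ (1 - p : ℝ) := by linarith [p.2.2]
  have hm : 0 ≤ (1 - p : ℝ) / p := by positivity
  have hr0 : 0 ≤ (1 - p : ℝ) ^ r * p := by positivity
  have hr1 : (1 - p : ℝ) ^ r * p ≤ 1 :=
    mul_le_one₀ (pow_le_one₀ hq0 (by linarith)) h0.le p.2.2
  have h1 : |(if k = r then (1 : ℝ) else 0) - (1 - p) ^ r * p| ^ 3 ≤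
      (if k = r then 1 else 0) + (1 - p) ^ r * p := by
    refine (pow_le_of_le_one (abs_nonneg _) ?_ three_ne_zero).trans ?_
    · split_ifs <;> rw [abs_le] <;> constructor <;> linarith
    · split_ifs <;> rw [abs_le] <;> constructor <;> linarith
  have h2 : |(k : ℝ) - (1 - p) / p| ^ 3 ≤ (k : ℝ) ^ 3 + ((1 - p) / p) ^ 3 := by
    have hk : (0 : ℝ) ≤ k := k.cast_nonneg
    rcases le_total (k : ℝ) ((1 - p) / p) with h | h
    · rw [abs_of_nonpos (by linarith)]
      have := pow_le_pow_left₀ (by linarith) (by linarith : -((k : ℝ) - (1 - p) / p) ≤ (1 - p) / p) 3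
      nlinarith [pow_nonneg hk 3]
    · rw [abs_of_nonneg (by linarith)]
      have := pow_le_pow_left₀ (by linarith) (by linarith : (k : ℝ) - (1 - p) / p ≤ k) 3
      nlinarith [pow_nonneg hm 3]
  refine (abs_add_pow_three_le _ _).trans ?_
  rw [abs_mul, abs_mul, mul_pow, mul_pow]
  have h3 := mul_le_mul_of_nonneg_left h1 (pow_nonneg (abs_nonneg t) 3)
  have h4 := mul_le_mul_of_nonneg_left h2 (pow_nonneg (abs_nonneg u) 3)
  linarith

lemma integrable_abs_geomCentred_cube (hp : p ≠ 0) (r : ℕ) (t u : ℝ) :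
    Integrable (fun k => |geomCentred p r t u k| ^ 3) (geometricMeasure p) := by
  have h1 := integrable_ite_geometricMeasure (p := p) r
  have h3 := integrable_geometricMeasure_pow hp 3
  have hc (c : ℝ) := integrable_const (μ := geometricMeasure p) c
  refine Integrable.mono' (g := fun k : ℕ =>
    4 * |t| ^ 3 * ((if k = r then 1 else 0) + (1 - p) ^ r * p)
      + (4 * |u| ^ 3 * (k : ℝ) ^ 3 + 4 * |u| ^ 3 * ((1 - p) / p) ^ 3))
    (((h1.fun_add (hc _)).const_mul _).fun_add ((h3.const_mul _).fun_add (hc _)))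
    (by fun_prop) (.of_forall fun k => ?_)
  rw [Real.norm_of_nonneg (by positivity)]
  exact abs_geomCentred_cube_le hp r t u k

lemma integral_abs_geomCentred_cube_le (hp : p ≠ 0) (r : ℕ) (t u : ℝ) :
    ∫ k, |geomCentred p r t u k| ^ 3 ∂geometricMeasure p ≤
      8 * |t| ^ 3 * ((1 - p) ^ r * p) + 28 * |u| ^ 3 * ((1 - p) / p ^ 3) := by
  have h0 : 0 < (p : ℝ) := unitInterval.pos_iff_ne_zero.2 hp
  have hq0 : 0 ≤ (1 - p : ℝ) := by linarith [p.2.2]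
  have h1 := integrable_ite_geometricMeasure (p := p) r
  have h3 := integrable_geometricMeasure_pow hp 3
  have hc (c : ℝ) := integrable_const (μ := geometricMeasure p) c
  refine (integral_mono (integrable_abs_geomCentred_cube hp r t u)
    (((h1.fun_add (hc _)).const_mul _).fun_add ((h3.const_mul _).fun_add (hc _)))
    (abs_geomCentred_cube_le hp r t u)).trans ?_
  rw [integral_add ((h1.fun_add (hc _)).const_mul _) ((h3.const_mul _).fun_add (hc _)),
    integral_add (h3.const_mul _) (hc _), integral_const_mul, integral_const_mul,
    integral_add h1 (hc _), integral_ite_geometricMeasure hp]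
  simp only [integral_const, probReal_univ, one_smul]
  have h4 := mul_le_mul_of_nonneg_left (integral_geometricMeasure_cube_le hp)
    (by positivity : 0 ≤ 4 * |u| ^ 3)
  have h5 : ((1 - p : ℝ) / p) ^ 3 ≤ (1 - p) / p ^ 3 := by
    rw [div_pow]
    gcongr
    exact pow_le_of_le_one hq0 (by linarith) three_ne_zero
  have h6 := mul_le_mul_of_nonneg_left h5 (by positivity : 0 ≤ 4 * |u| ^ 3)
  rw [mul_div_assoc] at h4
  linarith

/-! ### Taylor expansion and decay of the characteristic function -/

lemma norm_cexp_ofReal_mul_I_sub_taylor_two_le (x : ℝ) :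
    ‖Complex.exp (x * Complex.I) - (1 + x * Complex.I - (x : ℂ) ^ 2 / 2)‖ ≤ 4 * |x| ^ 3 := by
  have hn : ‖(x : ℂ) * Complex.I‖ = |x| := by simp
  rcases le_total |x| 1 with h | h
  · have := Complex.exp_bound (x := x * Complex.I) (by rwa [hn]) (n := 3) (by norm_num)
    rw [hn] at this
    have he : ∑ m ∈ Finset.range 3, ((x : ℂ) * Complex.I) ^ m / (m.factorial : ℂ) =
        1 + x * Complex.I - (x : ℂ) ^ 2 / 2 := by
      simp [Finset.sum_range_succ, mul_pow]
      ring
    rw [he] at this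
    refine this.trans ?_
    norm_num [Nat.factorial]
    nlinarith [pow_nonneg (abs_nonneg x) 3]
  -- For `|x| ≥ 1` the triangle inequality suffices, each power of `|x|` being at most `|x| ^ 3`.
  · have h1 : ‖Complex.exp (x * Complex.I)‖ = 1 := Complex.norm_exp_ofReal_mul_I x
    have h2 : ‖1 + x * Complex.I - (x : ℂ) ^ 2 / 2‖ ≤ 1 + |x| + |x| ^ 2 / 2 := by
      refine (norm_sub_le _ _).trans (add_le_add ((norm_add_le _ _).trans ?_) ?_) <;> simp
    refine (norm_sub_le _ _).trans ?_
    rw [h1]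
    have h3 : |x| ≤ |x| ^ 3 := le_self_pow₀ h three_ne_zero
    have h4 : |x| ^ 2 ≤ |x| ^ 3 := pow_le_pow_right₀ h (by norm_num)
    linarith

/-- The characteristic function of the centred pair `(1{k = r}, k)` under the geometric
distribution. -/
noncomputable def geomCharFun (p : unitInterval) (r : ℕ) (t u : ℝ) : ℂ :=
  ∫ k, Complex.exp (geomCentred p r t u k * Complex.I) ∂geometricMeasure p

lemma integrable_cexp_geomCentred (r : ℕ) (t u : ℝ) :
    Integrable (fun k => Complex.exp (geomCentred p r t u k * Complex.I)) (geometricMeasure p) :=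
  Integrable.of_bound (C := 1) (by fun_prop)
    (.of_forall fun k => (Complex.norm_exp_ofReal_mul_I _).le)

lemma norm_geomCharFun_sub_le (hp : p ≠ 0) (r : ℕ) (t u : ℝ) :
    ‖geomCharFun p r t u -
      (1 - ((∫ k, geomCentred p r t u k ^ 2 ∂geometricMeasure p : ℝ) : ℂ) / 2)‖ ≤
      32 * |t| ^ 3 * ((1 - p) ^ r * p) + 112 * |u| ^ 3 * ((1 - p) / p ^ 3) := by
  have h1 : Integrable (fun k => (geomCentred p r t u k : ℂ) * Complex.I) (geometricMeasure p) :=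
    (integrable_geomCentred hp r t u).ofReal.mul_const _
  have h2 : Integrable (fun k => ((geomCentred p r t u k ^ 2 : ℝ) : ℂ) / 2) (geometricMeasure p) :=
    (integrable_geomCentred_sq hp r t u).ofReal.div_const _
  have h3 : Integrable (fun k => 1 + (geomCentred p r t u k : ℂ) * Complex.I)
    (geometricMeasure p) := (integrable_const _).add h1
  have h4 : Integrable (fun k => 1 + (geomCentred p r t u k : ℂ) * Complex.I
      - ((geomCentred p r t u k ^ 2 : ℝ) : ℂ) / 2) (geometricMeasure p) := h3.sub h2
  have hI : ∫ k, (1 + (geomCentred p r t u k : ℂ) * Complex.I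
      - ((geomCentred p r t u k ^ 2 : ℝ) : ℂ) / 2) ∂geometricMeasure p =
      1 - ((∫ k, geomCentred p r t u k ^ 2 ∂geometricMeasure p : ℝ) : ℂ) / 2 := by
    rw [integral_sub h3 h2, integral_add (integrable_const _) h1, integral_mul_const, integral_div,
      integral_complex_ofReal, integral_complex_ofReal, integral_geomCentred hp]
    simp
  rw [← hI, geomCharFun, ← integral_sub (integrable_cexp_geomCentred r t u) h4]
  refine (norm_integral_le_of_norm_le ((integrable_abs_geomCentred_cube hp r t u).const_mul 4)
    (.of_forall fun k => ?_)).trans ?_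
  · have := norm_cexp_ofReal_mul_I_sub_taylor_two_le (geomCentred p r t u k)
    push_cast
    exact this
  · rw [integral_const_mul]
    linarith [integral_abs_geomCentred_cube_le hp r t u]

/-- With `y = a * b * (1 - cos u)` the squared norm is `(a + b) ^ 2 - 2 * y`, which is at most `(a +
b - y) ^ 2` because `a + b ≤ 1`. -/
lemma norm_add_mul_cexp_le {a b : ℝ} (ha : 0 < a) (hb : 0 ≤ b) (hab : a + b ≤ 1) (u : ℝ) :
    ‖(a : ℂ) + b * Complex.exp (u * Complex.I)‖ ≤ a + b - a * b * (1 - Real.cos u) := by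
  have hc1 := Real.neg_one_le_cos u
  have hc2 := Real.cos_le_one u
  have hsq : ‖(a : ℂ) + b * Complex.exp (u * Complex.I)‖ ^ 2 =
      (a + b) ^ 2 - 2 * (a * b * (1 - Real.cos u)) := by
    rw [← Complex.normSq_eq_norm_sq, Complex.exp_mul_I, Complex.normSq_apply]
    simp [Complex.cos_ofReal_re, Complex.sin_ofReal_re, Complex.cos_ofReal_im,
      Complex.sin_ofReal_im]
    linear_combination b ^ 2 * Real.sin_sq_add_cos_sq u
  have hx : 0 ≤ a * b * (1 - Real.cos u) := mul_nonneg (mul_nonneg ha.le hb) (by linarith)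
  have hx2 : a * b * (1 - Real.cos u) ≤ a + b := by
    have : a * b ≤ a * 1 := by gcongr; linarith
    have h4 : a * b * (1 - Real.cos u) ≤ a * b * 2 := by
      apply mul_le_mul_of_nonneg_left (by linarith) (by positivity)
    nlinarith [mul_nonneg ha.le hb, sq_nonneg (a - b), mul_nonneg (add_nonneg ha.le hb) (sub_nonneg.2 hab)]
  refine abs_le_of_sq_le_sq' ?_ (by linarith) |>.2
  rw [hsq]
  nlinarith [sq_nonneg (a * b * (1 - Real.cos u))]

/-- Only the atoms `a` and `a + 1` are used: neither is `r`, so their relative phase is `u`, and the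
bound is uniform in `t`. All other atoms are bounded by their mass. -/
lemma norm_geomCharFun_le (hp : p ≠ 0) {r a : ℕ} (ha : a ≠ r) (ha' : a + 1 ≠ r) (t u : ℝ) :
    ‖geomCharFun p r t u‖ ≤
      1 - ((1 - p) ^ a * p) * ((1 - p) ^ (a + 1) * p) * (1 - Real.cos u) := by
  have h0 : 0 < (p : ℝ) := unitInterval.pos_iff_ne_zero.2 hp
  have hq0 : 0 ≤ (1 - p : ℝ) := by linarith [p.2.2]
  set X := geomCentred p r t u with hX
  have hs := hasSum_integral_geometricMeasure hp (integrable_cexp_geomCentred (p := p) r t u)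
  have hs1 := hasSum_one_geometricMeasure hp
  set w : ℕ → ℝ := fun n => (1 - p : ℝ) ^ n * p with hw
  have hw0 : ∀ n, 0 ≤ w n := geometricMeasure_nonneg p
  have hne : a ≠ a + 1 := by omega
  set s : Finset ℕ := {a, a + 1} with hsdef
  have e1 := hs1.summable.sum_add_tsum_subtype_compl s
  have e2 := hs.summable.sum_add_tsum_subtype_compl s
  rw [hs1.tsum_eq, Finset.sum_pair hne] at e1
  rw [hs.tsum_eq, Finset.sum_pair hne] at e2
  rw [geomCharFun, ← e2]
  have htail : ‖∑' x : {x // x ∉ s}, w x • Complex.exp (X x * Complex.I)‖ ≤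
      1 - (w a + w (a + 1)) := by
    have hn : ∀ k, ‖w k • Complex.exp (X k * Complex.I)‖ = w k := fun k => by
      rw [norm_smul, Complex.norm_exp_ofReal_mul_I, mul_one, Real.norm_of_nonneg (hw0 k)]
    refine (norm_tsum_le_tsum_norm ?_).trans (le_of_eq ?_)
    · simp_rw [hn]; exact hs1.summable.subtype _
    · simp_rw [hn]; linarith
  have hX1 : X (a + 1) = X a + u := by
    simp [hX, geomCentred, ha, ha']; ring
  have hle1 : w a + w (a + 1) ≤ 1 := by
    have : 0 ≤ ∑' x : {x // x ∉ s}, w x := tsum_nonneg fun x => hw0 x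
    linarith
  have hhead : ‖w a • Complex.exp (X a * Complex.I) + w (a + 1) •
      Complex.exp (X (a + 1) * Complex.I)‖ ≤
        w a + w (a + 1) - w a * w (a + 1) * (1 - Real.cos u) := by
    rcases hq0.eq_or_lt with h | h
    · have hz : w (a + 1) = 0 := by simp [hw, ← h]
      rw [hz]
      simp only [zero_smul, add_zero, mul_zero, zero_mul, sub_zero]
      rw [norm_smul, Complex.norm_exp_ofReal_mul_I, mul_one, Real.norm_of_nonneg (hw0 a)]
    · have : w a • Complex.exp (X a * Complex.I) + w (a + 1) • Complex.exp (X (a + 1) * Complex.I)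
          = Complex.exp (X a * Complex.I) *
            ((w a : ℂ) + w (a + 1) * Complex.exp (u * Complex.I)) := by
        rw [hX1]; push_cast
        rw [add_mul, Complex.exp_add, Complex.real_smul, Complex.real_smul]; ring
      rw [this, norm_mul, Complex.norm_exp_ofReal_mul_I, one_mul]
      exact norm_add_mul_cexp_le (mul_pos (pow_pos h a) h0) (hw0 _) hle1 u
  exact (norm_add_le _ _).trans (by linarith)

end Geometric

/-! ### Conditioning a geometric vector on its sum -/

lemma coe_piAntidiag_univ (n N : ℕ) :
    (((Finset.univ : Finset (Fin N)).piAntidiag n : Finset (Fin N → ℕ)) : Set (Fin N → ℕ)) =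
      {k | ∑ i, k i = n} := by
  ext k; simp

lemma integral_indistinguishableBallsLaw {E : Type*} [NormedAddCommGroup E] [NormedSpace ℝ E]
    [CompleteSpace E] (n N : ℕ) (g : (Fin N → ℕ) → E) :
    ∫ k, g k ∂indistinguishableBallsLaw n N =
      (((Finset.univ : Finset (Fin N)).piAntidiag n).card : ℝ)⁻¹ •
        ∑ k ∈ (Finset.univ : Finset (Fin N)).piAntidiag n, g k := by
  rw [indistinguishableBallsLaw, ← coe_piAntidiag_univ, uniformOn, ProbabilityTheory.cond,
    integral_smul_measure, setIntegral_finset]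
  · simp [Measure.count_apply_finset, measureReal_def]
  · have : IsFiniteMeasure ((Measure.count : Measure (Fin N → ℕ)).restrict
        ((Finset.univ : Finset (Fin N)).piAntidiag n)) :=
      ⟨by rw [Measure.restrict_apply_univ, Measure.count_apply_finset]; finiteness⟩
    have h := IntegrableOn.finset (s := (Finset.univ : Finset (Fin N)).piAntidiag n) (f := g)
      (μ := (Measure.count : Measure (Fin N → ℕ)).restrict
        ((Finset.univ : Finset (Fin N)).piAntidiag n))
    rwa [IntegrableOn, Measure.restrict_restrict (Finset.measurableSet _), Set.inter_self] at h

section Fourier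

variable {p : unitInterval} {N : ℕ}

/-- Since `hn` makes the mean of the sum equal to `n`, the coefficient of `u` is an integer, as
orthogonality over `[-π, π]` requires. -/
lemma sum_geomCentred {n : ℕ} (hn : (N : ℝ) * ((1 - p) / p) = n) (r : ℕ) (t u : ℝ)
    (k : Fin N → ℕ) :
    ∑ i, geomCentred p r t u (k i) =
      t * (boxesWithExactly r k - N * ((1 - p) ^ r * p)) + ((∑ i, k i : ℕ) - (n : ℤ) : ℤ) * u := by
  simp only [geomCentred, Finset.sum_add_distrib, ← Finset.mul_sum, Finset.sum_sub_distrib,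
    boxesWithExactly]
  simp [hn]
  ring

lemma integral_cexp_intCast_mul (m : ℤ) :
    ∫ u in -Real.pi..Real.pi, Complex.exp (((m * u : ℝ) : ℂ) * Complex.I) =
      if m = 0 then (2 * Real.pi : ℂ) else 0 := by
  split_ifs with h
  · subst h; simp; ring
  · have hc : (m : ℂ) * Complex.I ≠ 0 := by simp [h]
    have he : ∀ u : ℝ, Complex.exp (((m * u : ℝ) : ℂ) * Complex.I) =
        Complex.exp ((m : ℂ) * Complex.I * u) := fun u => by push_cast; ring_nf
    simp_rw [he]
    rw [integral_exp_mul_complex hc, div_eq_zero_iff, sub_eq_zero]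
    left
    rw [Complex.exp_eq_exp_iff_exists_int]
    exact ⟨m, by push_cast; ring⟩

/-- Independence turns the power into an expectation over the product measure; after exchanging
integrals, the `u`-integral keeps only the vectors of sum `n`. -/
lemma integral_geomCharFun_pow {n : ℕ} (hp : p ≠ 0) (hn : (N : ℝ) * ((1 - p) / p) = n)
    (r : ℕ) (t : ℝ) :
    ∫ u in -Real.pi..Real.pi, geomCharFun p r t u ^ N =
      (2 * Real.pi * ((1 - p) ^ n * p ^ N) : ℝ) *
        ∑ k ∈ (Finset.univ : Finset (Fin N)).piAntidiag n,
          Complex.exp ((t * (boxesWithExactly r k - N * ((1 - p) ^ r * p)) : ℝ) * Complex.I) := by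
  set ν : Measure (Fin N → ℕ) := Measure.pi fun _ => geometricMeasure p with hν
  set A : (Fin N → ℕ) → ℂ := fun k =>
    Complex.exp ((t * (boxesWithExactly r k - N * ((1 - p) ^ r * p)) : ℝ) * Complex.I) with hA
  have hpow : ∀ u : ℝ, geomCharFun p r t u ^ N =
      ∫ k, A k * Complex.exp (((((∑ i, k i : ℕ) - (n : ℤ) : ℤ) * u : ℝ) : ℂ) * Complex.I) ∂ν := by
    intro u
    have := integral_fintype_prod_eq_pow (ι := Fin N) (μ := geometricMeasure p)
      (fun k => Complex.exp (geomCentred p r t u k * Complex.I))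
    rw [Fintype.card_fin] at this
    rw [geomCharFun, ← this]
    congr 1 with k
    rw [← Complex.exp_sum, ← Complex.exp_add, ← Finset.sum_mul, ← Complex.ofReal_sum,
      sum_geomCentred hn]
    push_cast
    ring_nf
  simp_rw [hpow]
  rw [intervalIntegral_integral_swap]
  · simp_rw [intervalIntegral.integral_const_mul, integral_cexp_intCast_mul]
    have hsupp : ∀ k ∉ (((Finset.univ : Finset (Fin N)).piAntidiag n : Finset (Fin N → ℕ)) :
        Set (Fin N → ℕ)), (A k * if ((∑ i, k i : ℕ) - (n : ℤ) : ℤ) = 0 then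
          (2 * Real.pi : ℂ) else 0) = 0 := by
      intro k hk
      rw [coe_piAntidiag_univ, Set.mem_ofPred_eq] at hk
      rw [if_neg (by omega), mul_zero]
    rw [← setIntegral_eq_integral_of_forall_compl_eq_zero hsupp, setIntegral_finset _
      IntegrableOn.finset, Finset.mul_sum]
    refine Finset.sum_congr rfl fun k hk => ?_
    have hk' : ∑ i, k i = n := by simpa using hk
    -- The mass depends on `k` only through its sum: this is why conditioning yields the uniform
    -- law.
    have hm : ν.real {k} = (1 - p) ^ n * p ^ N := by
      rw [measureReal_def, hν, Measure.pi_singleton, ENNReal.toReal_prod]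
      simp_rw [← measureReal_def, geometricMeasure_real_singleton hp]
      rw [Finset.prod_mul_distrib, Finset.prod_pow_eq_pow_sum, hk']
      simp
    rw [hm, if_pos (by omega), Complex.real_smul]
    change _ = _ * A k
    push_cast
    ring
  · have : IsFiniteMeasure (volume.restrict (Set.uIoc (-Real.pi) Real.pi)) :=
      ⟨by rw [Measure.restrict_apply_univ, Set.uIoc, Real.volume_Ioc]; exact ENNReal.ofReal_lt_top⟩
    refine Integrable.of_bound (C := 1) ?_ (.of_forall fun x => ?_)
    · refine Measurable.aestronglyMeasurable ?_
      simp only [Function.uncurry_def]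
      have h1 : Measurable fun x : ℝ × (Fin N → ℕ) => A x.2 :=
        (Measurable.of_discrete (f := A)).comp measurable_snd
      have h2 : Measurable fun x : ℝ × (Fin N → ℕ) =>
          ((((∑ i, x.2 i : ℕ) - (n : ℤ) : ℤ) : ℝ)) :=
        (Measurable.of_discrete
          (f := fun k : Fin N → ℕ => ((((∑ i, k i : ℕ) - (n : ℤ) : ℤ) : ℝ)))).comp measurable_snd
      exact h1.mul (Complex.measurable_exp.comp ((Complex.measurable_ofReal.comp
        (h2.mul measurable_fst)).mul_const _))
    · rw [Function.uncurry_def, norm_mul, hA, Complex.norm_exp_ofReal_mul_I,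
        Complex.norm_exp_ofReal_mul_I, mul_one]

lemma integral_cexp_boxesWithExactly {n : ℕ} (hp : p ≠ 0) (hp1 : p ≠ 1)
    (hn : (N : ℝ) * ((1 - p) / p) = n) (r : ℕ) (t : ℝ) :
    ∫ k, Complex.exp ((t * (boxesWithExactly r k - N * ((1 - p) ^ r * p)) : ℝ) * Complex.I)
        ∂indistinguishableBallsLaw n N =
      (∫ u in -Real.pi..Real.pi, geomCharFun p r t u ^ N) /
        ∫ u in -Real.pi..Real.pi, geomCharFun p r 0 u ^ N := by
  have h0 : 0 < (p : ℝ) := unitInterval.pos_iff_ne_zero.2 hp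
  have h1 : (p : ℝ) < 1 := unitInterval.lt_one_iff_ne_one.2 hp1
  have hc : ((2 * Real.pi * ((1 - p) ^ n * p ^ N) : ℝ) : ℂ) ≠ 0 := by
    have : 0 < (1 - p : ℝ) := by linarith
    have : 2 * Real.pi * ((1 - p : ℝ) ^ n * (p : ℝ) ^ N) ≠ 0 := by positivity
    exact_mod_cast this
  rw [integral_geomCharFun_pow hp hn, integral_geomCharFun_pow hp hn,
    integral_indistinguishableBallsLaw, mul_div_mul_left _ _ hc]
  simp only [zero_mul, Complex.ofReal_zero, Complex.exp_zero, Finset.sum_const, nsmul_eq_mul,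
    mul_one, Complex.real_smul]
  push_cast
  rw [div_eq_inv_mul]

end Fourier

/-! ### The expected number of boxes with exactly `r` balls -/

lemma card_piAntidiag_univ_fin (n N : ℕ) :
    ((Finset.univ : Finset (Fin N)).piAntidiag n).card = (N + n - 1).choose n := by
  have := Finset.card_finsuppAntidiag_nat_eq_choose (s := (Finset.univ : Finset (Fin N))) n
  rw [Finset.card_univ, Fintype.card_fin] at this
  rw [← this]
  refine (Finset.card_equiv Finsupp.equivFunOnFinite fun k => ?_).symm
  simp [Finset.mem_finsuppAntidiag]

lemma card_piAntidiag_filter_eq {n r M : ℕ} (hr : r ≤ n) (i : Fin (M + 1)) :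
    (((Finset.univ : Finset (Fin (M + 1))).piAntidiag n).filter fun k => k i = r).card =
      ((Finset.univ : Finset (Fin M)).piAntidiag (n - r)).card := by
  refine Finset.card_nbij' (fun k => i.removeNth k) (fun k => i.insertNth r k) ?_ ?_ ?_ ?_
  · intro k hk
    simp only [Finset.coe_filter, Finset.mem_piAntidiag, Finset.mem_univ, implies_true, and_true,
      Set.mem_ofPred_eq] at hk
    have h := hk.1.symm.trans (Fin.sum_univ_succAbove k i)
    have : ∑ j, i.removeNth k j = n - r := by
      simp only [Fin.removeNth]
      omega
    simpa using this
  · intro k hk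
    have hk' : ∑ j, k j = n - r := by simpa using hk
    simp [Fin.sum_univ_succAbove _ i, hk', hr]
  · intro k hk
    simp only [Finset.coe_filter, Finset.mem_piAntidiag, Finset.mem_univ, implies_true, and_true,
      Set.mem_ofPred_eq] at hk
    change i.insertNth r (i.removeNth k) = k
    rw [← hk.2]
    exact Fin.insertNth_self_removeNth i k
  · intro k _
    simp

lemma sum_boxesWithExactly {n r M : ℕ} (hr : r ≤ n) :
    ∑ k ∈ (Finset.univ : Finset (Fin (M + 1))).piAntidiag n, boxesWithExactly r k =
      (M + 1) * (M + (n - r) - 1).choose (n - r) := by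
  simp only [boxesWithExactly]
  rw [Finset.sum_comm]
  simp_rw [← Finset.card_filter, card_piAntidiag_filter_eq hr, card_piAntidiag_univ_fin]
  simp

lemma choose_div_choose_eq {n r M : ℕ} (hr : r ≤ n) (hM : 1 ≤ M) :
    ((M + (n - r) - 1).choose (n - r) : ℝ) / ((M + n).choose n : ℝ) =
      M * n.descFactorial r / (M + n).descFactorial (r + 1) := by
  have h1 := Nat.factorial_mul_descFactorial hr
  have h2 := Nat.factorial_mul_descFactorial (show r + 1 ≤ M + n by omega)
  have h3 := Nat.choose_mul_factorial_mul_factorial (show n - r ≤ M + (n - r) - 1 by omega)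
  have h4 := Nat.choose_mul_factorial_mul_factorial (show n ≤ M + n by omega)
  rw [show M + (n - r) - 1 - (n - r) = M - 1 by omega] at h3
  rw [show M + n - n = M by omega] at h4
  rw [show M + n - (r + 1) = M + (n - r) - 1 by omega] at h2
  have h5 := Nat.mul_factorial_pred (show M ≠ 0 by omega)
  have hd : (M + n).descFactorial (r + 1) ≠ 0 := by
    rw [Ne, Nat.descFactorial_eq_zero_iff_lt]; omega
  have hc : (M + n).choose n ≠ 0 := (Nat.choose_pos (by omega)).ne'
  rw [div_eq_div_iff (by exact_mod_cast hc) (by exact_mod_cast hd)]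
  norm_cast
  -- Multiplying by these factorials turns both sides into `(M + n)! * n! * M!`.
  have hpos : 0 < (n - r).factorial * (M - 1).factorial * n.factorial * M.factorial := by
    have := Nat.factorial_pos
    exact Nat.mul_pos (Nat.mul_pos (Nat.mul_pos (this _) (this _)) (this _)) (this _)
  refine Nat.eq_of_mul_eq_mul_left hpos ?_
  calc _ = ((M + (n - r) - 1).choose (n - r) * (n - r).factorial * (M - 1).factorial) *
        (M + n).descFactorial (r + 1) * n.factorial * M.factorial := by ring
    _ = (M + n).factorial * n.factorial * M.factorial := by rw [h3, h2]
    _ = ((M + n).choose n * n.factorial * M.factorial) * ((n - r).factorial * n.descFactorial r)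
        * (M * (M - 1).factorial) := by rw [h4, h1, h5]
    _ = _ := by ring

lemma integral_boxesWithExactly {n r N : ℕ} (hr : r ≤ n) (hN : 2 ≤ N) :
    ∫ k, (boxesWithExactly r k : ℝ) ∂indistinguishableBallsLaw n N =
      N * ((N - 1) * n.descFactorial r / (N + n - 1).descFactorial (r + 1)) := by
  obtain ⟨M, rfl⟩ : ∃ M, N = M + 1 := ⟨N - 1, by omega⟩
  rw [integral_indistinguishableBallsLaw, ← Nat.cast_sum, sum_boxesWithExactly hr,
    card_piAntidiag_univ_fin, show M + 1 + n - 1 = M + n by omega]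
  have := choose_div_choose_eq hr (show 1 ≤ M by omega)
  push_cast
  rw [add_sub_cancel_right, ← this, smul_eq_mul]
  ring

/-! ### Relative error of the approximate mean -/

section Asymptotics

open Asymptotics

lemma isBigO_mul_sub_one {ι : Type*} {l : Filter ι} {f g e : ι → ℝ} (he : Tendsto e l (𝓝 0))
    (hf : (fun i => f i - 1) =O[l] e) (hg : (fun i => g i - 1) =O[l] e) :
    (fun i => f i * g i - 1) =O[l] e := by
  have hg1 : g =O[l] fun _ => (1 : ℝ) := by
    have h1 : (fun i => g i - 1) =O[l] fun _ => (1 : ℝ) := hg.trans (he.isBigO_one ℝ)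
    simpa using h1.add (isBigO_refl (fun _ => (1 : ℝ)) l)
  have h2 := (hf.mul hg1).add (hg.trans_eventuallyEq (g₂ := fun i => e i * 1) (by simp))
  refine (h2.congr_left fun i => by ring).trans_eventuallyEq (by simp)

lemma isBigO_inv_sub_one {ι : Type*} {l : Filter ι} {f e : ι → ℝ} (he : Tendsto e l (𝓝 0))
    (hf : (fun i => f i - 1) =O[l] e) :
    (fun i => (f i)⁻¹ - 1) =O[l] e := by
  have hf1 : Tendsto f l (𝓝 1) := by
    simpa using (hf.trans_tendsto he).add_const 1
  have hi : (fun i => (f i)⁻¹) =O[l] fun _ => (1 : ℝ) :=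
    (hf1.inv₀ one_ne_zero).isBigO_one ℝ
  have h := (hf.neg_left.mul hi).trans_eventuallyEq (g₂ := e) (by simp)
  refine h.congr' ?_ EventuallyEq.rfl
  filter_upwards [hf1.eventually_ne one_ne_zero] with i hi
  field_simp
  ring

lemma isBigO_descFactorial_div_pow_sub_one {a : ℕ → ℕ} (ha : ∀ᶠ n in atTop, n ≤ a n) (r : ℕ) :
    (fun n => ((a n).descFactorial r : ℝ) / (a n : ℝ) ^ r - 1) =O[atTop]
      fun n : ℕ => (1 : ℝ) / n := by
  induction r with
  | zero => simpa using isBigO_zero _ _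
  | succ r ih =>
    have h1 : (fun n => (1 - (r : ℝ) / a n) - 1) =O[atTop] fun n : ℕ => (1 : ℝ) / n := by
      refine IsBigO.of_bound r ?_
      filter_upwards [ha, eventually_gt_atTop 0] with n hn hn0
      have h0 : (0 : ℝ) < n := by exact_mod_cast hn0
      have h2 : (n : ℝ) ≤ a n := by exact_mod_cast hn
      have : (1 - (r : ℝ) / a n) - 1 = - (r / a n) := by ring
      rw [this, norm_neg, Real.norm_of_nonneg (by positivity), Real.norm_of_nonneg (by positivity),
        mul_one_div]
      gcongr
    refine (isBigO_mul_sub_one tendsto_one_div_atTop_nhds_zero_nat h1 ih).congr' ?_ EventuallyEq.rfl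
    filter_upwards [ha, eventually_ge_atTop (r + 1)] with n hn hr
    have h0 : (a n : ℝ) ≠ 0 := by
      have : 0 < a n := by omega
      positivity
    rw [Nat.descFactorial_succ, Nat.cast_mul, Nat.cast_sub (by omega), pow_succ', one_sub_div h0,
      div_mul_div_comm]

/-- The success probability `N / (N + n)` for which a geometric variable has mean `n / N`. -/
noncomputable def occupancyParam (n N : ℕ) : unitInterval :=
  ⟨N / (N + n), by positivity, div_le_one_of_le₀ (by simp) (by positivity)⟩

lemma coe_occupancyParam (n N : ℕ) : (occupancyParam n N : ℝ) = N / (N + n) := rfl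

lemma exists_integral_boxesWithExactly_eq {N : ℕ → ℕ} {C : ℝ} (hN : Tendsto N atTop atTop)
    (hC : ∀ᶠ n : ℕ in atTop, (n : ℝ) / N n ≤ C) (r : ℕ) :
    ∃ ρ : ℕ → ℝ, (fun n => ρ n - 1) =O[atTop] (fun n : ℕ => (1 : ℝ) / n) ∧
      ∀ᶠ n in atTop, ∫ k, (boxesWithExactly r k : ℝ) ∂indistinguishableBallsLaw n (N n) =
        N n * ((1 - occupancyParam n (N n)) ^ r * occupancyParam n (N n)) * ρ n := by
  have he := tendsto_one_div_atTop_nhds_zero_nat (𝕜 := ℝ)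
  have h1 : (fun n => (1 - (1 : ℝ) / N n) - 1) =O[atTop] fun n : ℕ => (1 : ℝ) / n := by
    refine IsBigO.of_bound C ?_
    filter_upwards [hC, eventually_gt_atTop 0, hN.eventually_gt_atTop 0] with n hn hn0 hN0
    have h0 : (0 : ℝ) < n := by exact_mod_cast hn0
    have hN0' : (0 : ℝ) < N n := by exact_mod_cast hN0
    have : (1 - (1 : ℝ) / N n) - 1 = - (1 / N n) := by ring
    rw [this, norm_neg, Real.norm_of_nonneg (by positivity), Real.norm_of_nonneg (by positivity),
      mul_one_div, le_div_iff₀ h0, one_div_mul_eq_div]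
    exact hn
  have h2 := isBigO_descFactorial_div_pow_sub_one (a := id) (.of_forall fun n => le_rfl) r
  have h3 := isBigO_descFactorial_div_pow_sub_one (a := fun n => N n + n)
    (.of_forall fun n => Nat.le_add_left _ _) (r + 2)
  refine ⟨_, isBigO_mul_sub_one he (isBigO_mul_sub_one he h1 h2) (isBigO_inv_sub_one he h3), ?_⟩
  filter_upwards [eventually_ge_atTop r, eventually_gt_atTop 0, hN.eventually_ge_atTop 2]
    with n hr hn0 hN2
  have h0 : (0 : ℝ) < n := by exact_mod_cast hn0
  have hN0 : (0 : ℝ) < N n := by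
    have : 0 < N n := by omega
    exact_mod_cast this
  -- One factor `N + n` of the power `(N + n) ^ (r + 2)` completes the falling factorial from `r +
  -- 1` to `r + 2` factors.
  rw [integral_boxesWithExactly hr hN2, coe_occupancyParam,
    show 1 - (N n : ℝ) / (N n + n) = n / (N n + n) by field_simp; ring,
    show N n + n = N n + n - 1 + 1 by omega, Nat.succ_descFactorial_succ,
    show N n + n - 1 + 1 = N n + n by omega]
  have hd : ((N n + n - 1).descFactorial (r + 1) : ℝ) ≠ 0 := by
    rw [Ne, Nat.cast_eq_zero, Nat.descFactorial_eq_zero_iff_lt]; omega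
  push_cast
  simp only [id]
  rw [div_pow]
  field_simp
  ring

end Asymptotics

/-! ### Asymptotics of the Fourier integrals -/

/-- Take `N * log z`: the error in `log (1 + y) = y + O(y ^ 2)` contributes `N * y * O(y) → 0`. -/
lemma tendsto_pow_cexp_of_tendsto_mul_sub_one {ι : Type*} {l : Filter ι} {N : ι → ℕ} {z : ι → ℂ}
    {w : ℂ} (hN : Tendsto N l atTop) (hz : Tendsto (fun i => (N i : ℂ) * (z i - 1)) l (𝓝 w)) :
    Tendsto (fun i => z i ^ N i) l (𝓝 (Complex.exp w)) := by
  have hinv : Tendsto (fun i => ((N i : ℂ))⁻¹) l (𝓝 0) :=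
    (tendsto_inv_atTop_nhds_zero_nat (𝕜 := ℂ)).comp hN
  have hg : Tendsto (fun i => z i - 1) l (𝓝 0) := by
    have := hinv.mul hz
    rw [zero_mul] at this
    refine this.congr' ?_
    filter_upwards [hN.eventually_gt_atTop 0] with i hi
    rw [inv_mul_cancel_left₀ (by exact_mod_cast hi.ne')]
  have hlog : Tendsto (fun i => (N i : ℂ) * Complex.log (1 + (z i - 1))) l (𝓝 w) := by
    have h1 : Tendsto (fun i => (N i : ℂ) * (Complex.log (1 + (z i - 1)) - (z i - 1))) l (𝓝 0) := by
      refine (((Asymptotics.isBigO_refl (fun i => (N i : ℂ)) l).mul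
        (Complex.log_sub_self_isBigO.comp_tendsto hg))).trans_tendsto ?_
      have := hz.mul hg
      rw [mul_zero] at this
      refine this.congr fun i => ?_
      simp only [Function.comp]
      ring
    have := h1.add hz
    rw [zero_add] at this
    exact this.congr fun i => by ring
  refine ((Complex.continuous_exp.tendsto _).comp hlog).congr' ?_
  filter_upwards [hg.eventually_ne (show (0 : ℂ) ≠ -1 by simp)] with i hi
  have h0 : z i ≠ 0 := fun h => hi (by simp [h])
  simp only [Function.comp, add_sub_cancel]
  rw [Complex.exp_nat_mul, Complex.exp_log h0]

lemma continuous_geomCharFun (p : unitInterval) (r : ℕ) (t : ℝ) :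
    Continuous (geomCharFun p r t) := by
  refine continuous_of_dominated (bound := fun _ => 1) (fun u => by fun_prop)
    (fun u => .of_forall fun k => (Complex.norm_exp_ofReal_mul_I _).le) (integrable_const _)
    (.of_forall fun k => ?_)
  unfold geomCentred
  fun_prop

/-- The variance `n (N + n) / N` of a sum of `N` geometric variables of mean `n / N`. -/
noncomputable def occupancySumVar (n N : ℕ) : ℝ := n * (N + n) / N

section Identities

variable {n N : ℕ}

lemma occupancyScale_eq (r : ℕ) (hN : 0 < N) :
    occupancyScale r n N = N * ((n : ℝ) / N) ^ r := by
  have : (N : ℝ) ≠ 0 := by positivity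
  rw [occupancyScale, zpow_sub_one₀ this, zpow_natCast, div_pow]
  field_simp

lemma occupancyScale_pos (r : ℕ) (hn : 0 < n) (hN : 0 < N) : 0 < occupancyScale r n N := by
  rw [occupancyScale_eq r hN]; positivity

lemma occupancySumVar_pos (hn : 0 < n) (hN : 0 < N) : 0 < occupancySumVar n N := by
  unfold occupancySumVar; positivity

lemma one_sub_occupancyParam (hN : 0 < N) : 1 - (occupancyParam n N : ℝ) = n / (N + n) := by
  rw [coe_occupancyParam]; field_simp; ring

lemma occupancyParam_ne_zero (hN : 0 < N) : occupancyParam n N ≠ 0 := by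
  have : 0 < (occupancyParam n N : ℝ) := by rw [coe_occupancyParam]; positivity
  exact unitInterval.pos_iff_ne_zero.1 this

lemma occupancyParam_ne_one (hn : 0 < n) (hN : 0 < N) : occupancyParam n N ≠ 1 := by
  have : 0 < 1 - (occupancyParam n N : ℝ) := by rw [one_sub_occupancyParam hN]; positivity
  exact unitInterval.lt_one_iff_ne_one.1 (by exact_mod_cast sub_pos.1 this)

lemma mul_occupancyParam_odds (hN : 0 < N) :
    (N : ℝ) * ((1 - occupancyParam n N) / occupancyParam n N) = n := by
  rw [one_sub_occupancyParam hN, coe_occupancyParam]; field_simp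

lemma occupancyParam_odds (hN : 0 < N) :
    (1 - occupancyParam n N : ℝ) / occupancyParam n N = n / N := by
  rw [one_sub_occupancyParam hN, coe_occupancyParam]; field_simp

lemma occupancyParam_eq (hN : 0 < N) : (occupancyParam n N : ℝ) = 1 / (1 + n / N) := by
  rw [coe_occupancyParam]; field_simp

/-- Identifies the scale as the order of the approximate mean count. -/
lemma mul_occupancyParam_div_scale (r : ℕ) (hn : 0 < n) (hN : 0 < N) :
    N * ((1 - occupancyParam n N : ℝ) ^ r * occupancyParam n N) =
      (occupancyParam n N : ℝ) ^ (r + 1) * occupancyScale r n N := by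
  rw [one_sub_occupancyParam hN, coe_occupancyParam, occupancyScale_eq r hN, div_pow, div_pow,
    div_pow]
  field_simp
  ring

lemma mul_occupancyParam_variance (hN : 0 < N) :
    N * ((1 - occupancyParam n N : ℝ) / (occupancyParam n N : ℝ) ^ 2) = occupancySumVar n N := by
  rw [one_sub_occupancyParam hN, coe_occupancyParam, occupancySumVar]; field_simp

end Identities

lemma tendsto_occupancyParam {N : ℕ → ℕ} {x : ℝ} (hx : 0 ≤ x) (hboxes : Tendsto N atTop atTop)
    (hratio : Tendsto (fun n : ℕ => (n : ℝ) / N n) atTop (𝓝 x)) :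
    Tendsto (fun n => (occupancyParam n (N n) : ℝ)) atTop (𝓝 (1 / (1 + x))) := by
  refine (tendsto_const_nhds.div (hratio.const_add 1) (by positivity)).congr' ?_
  filter_upwards [hboxes.eventually_gt_atTop 0] with n hn
  exact (occupancyParam_eq hn).symm

/-- The asymptotic regime in which the occupancy counts are asymptotically normal: `n / N → x`,
the scale diverges, its quotient by the variance of the geometric sum tends to `β`, and two
consecutive values `a, a + 1 ≠ r` jointly carry a mass comparable to the failure probability. -/
structure OccupancyRegime (r : ℕ) (N : ℕ → ℕ) (x β c : ℝ) (a : ℕ) : Prop where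
  tendsto_boxes : Tendsto N atTop atTop
  tendsto_ratio : Tendsto (fun n : ℕ => (n : ℝ) / N n) atTop (𝓝 x)
  tendsto_scale : Tendsto (fun n => occupancyScale r n (N n)) atTop atTop
  tendsto_scale_div : Tendsto (fun n => occupancyScale r n (N n) / occupancySumVar n (N n))
    atTop (𝓝 β)
  ne_left : a ≠ r
  ne_right : a + 1 ≠ r
  pos : 0 < c
  eventually_le : ∀ᶠ n in atTop, c * (1 - occupancyParam n (N n) : ℝ) ≤
    ((1 - occupancyParam n (N n)) ^ a * occupancyParam n (N n)) *
      ((1 - occupancyParam n (N n)) ^ (a + 1) * occupancyParam n (N n))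

/-- The limiting quadratic form is `(v + s D) ^ 2 + s ^ 2 σ ^ 2`; this is `D`. -/
noncomputable def occupancyShift (r : ℕ) (x β : ℝ) : ℝ :=
  (1 / (1 + x)) ^ (r + 1) * (r - x) * √β

/-- The limiting variance in terms of the limits `x` of `n / N` and `β` of the scale divided by the
variance of the geometric sum. -/
noncomputable def occupancyLimitVar (r : ℕ) (x β : ℝ) : ℝ :=
  (1 / (1 + x)) ^ (r + 1) * (1 - (1 - 1 / (1 + x)) ^ r * (1 / (1 + x))) - occupancyShift r x β ^ 2

namespace OccupancyRegime

variable {r : ℕ} {N : ℕ → ℕ} {x β c : ℝ} {a : ℕ}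

lemma ratio_nonneg (h : OccupancyRegime r N x β c a) : 0 ≤ x :=
  ge_of_tendsto' h.tendsto_ratio fun n => by positivity

lemma tendsto_param (h : OccupancyRegime r N x β c a) :
    Tendsto (fun n => (occupancyParam n (N n) : ℝ)) atTop (𝓝 (1 / (1 + x))) :=
  tendsto_occupancyParam h.ratio_nonneg h.tendsto_boxes h.tendsto_ratio

lemma tendsto_sumVar (h : OccupancyRegime r N x β c a) :
    Tendsto (fun n => occupancySumVar n (N n)) atTop atTop := by
  refine tendsto_atTop_mono' _ ?_ tendsto_natCast_atTop_atTop
  filter_upwards [h.tendsto_boxes.eventually_gt_atTop 0] with n hn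
  have : (0 : ℝ) < N n := by exact_mod_cast hn
  rw [occupancySumVar, le_div_iff₀ this]
  gcongr
  simp

/-- The cross term is the covariance, with limit coefficient `2 * s * v * D`; completing the square
in `v` costs the `D ^ 2` subtracted in `occupancyLimitVar`. -/
lemma tendsto_mul_integral_sq (h : OccupancyRegime r N x β c a) (s v : ℝ) :
    Tendsto (fun n => (N n : ℝ) * ∫ k, geomCentred (occupancyParam n (N n)) r
        (s / √(occupancyScale r n (N n))) (v / √(occupancySumVar n (N n))) k ^ 2
          ∂geometricMeasure (occupancyParam n (N n))) atTop
      (𝓝 ((v + s * occupancyShift r x β) ^ 2 + s ^ 2 * occupancyLimitVar r x β)) := by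
  have hp := h.tendsto_param
  have h1 := (((hp.pow (r + 1)).mul (((((hp.const_sub 1).pow r).mul hp).const_sub 1))).const_mul
    (s ^ 2)).add (((((hp.pow (r + 1)).mul (h.tendsto_ratio.const_sub (r : ℝ))).mul
      (h.tendsto_scale_div.sqrt)).const_mul (2 * s * v)).add_const (v ^ 2))
  have he : (v + s * occupancyShift r x β) ^ 2 + s ^ 2 * occupancyLimitVar r x β =
      s ^ 2 * ((1 / (1 + x)) ^ (r + 1) * (1 - (1 - 1 / (1 + x)) ^ r * (1 / (1 + x)))) +
        (2 * s * v * ((1 / (1 + x)) ^ (r + 1) * (r - x) * √β) + v ^ 2) := by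
    rw [occupancyLimitVar, occupancyShift]; ring
  rw [he]
  refine h1.congr' ?_
  filter_upwards [h.tendsto_boxes.eventually_gt_atTop 0, eventually_gt_atTop 0] with n hN hn
  have hB := occupancyScale_pos r hn hN
  have hV := occupancySumVar_pos hn hN
  have e1 := mul_occupancyParam_div_scale r hn hN
  have e2 := mul_occupancyParam_variance (n := n) hN
  rw [integral_geomCentred_sq (occupancyParam_ne_zero hN), occupancyParam_odds hN,
    Real.sqrt_div hB.le, div_pow, div_pow, Real.sq_sqrt hB.le, Real.sq_sqrt hV.le]
  set B := occupancyScale r n (N n)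
  set V := occupancySumVar n (N n)
  set p := (occupancyParam n (N n) : ℝ)
  have hsB : √B * √B = B := Real.mul_self_sqrt hB.le
  have hsB0 : 0 < √B := Real.sqrt_pos.2 hB
  have hsV0 : 0 < √V := Real.sqrt_pos.2 hV
  symm
  calc _ = s ^ 2 * ((N n * ((1 - p) ^ r * p)) / B) * (1 - (1 - p) ^ r * p)
        + 2 * s * v * ((N n * ((1 - p) ^ r * p)) / √B) * (r - n / N n) / √V
        + v ^ 2 * ((N n * ((1 - p) / p ^ 2)) / V) := by ring
    _ = _ := by
      rw [e1, e2, div_self hV.ne', mul_div_assoc (p ^ (r + 1)), div_self hB.ne',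
        mul_div_assoc (p ^ (r + 1)), show B / √B = √B by rw [div_eq_iff hsB0.ne', hsB]]
      ring

/-- `N` times the third-order error is `O(1 / √B + 1 / √V)`. -/
lemma tendsto_geomCharFun_pow (h : OccupancyRegime r N x β c a) (s v : ℝ) :
    Tendsto (fun n => geomCharFun (occupancyParam n (N n)) r
        (s / √(occupancyScale r n (N n))) (v / √(occupancySumVar n (N n))) ^ N n) atTop
      (𝓝 (Complex.exp ((-((v + s * occupancyShift r x β) ^ 2
        + s ^ 2 * occupancyLimitVar r x β) / 2 : ℝ)))) := by
  refine tendsto_pow_cexp_of_tendsto_mul_sub_one h.tendsto_boxes ?_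
  have hp := h.tendsto_param
  have hx := h.ratio_nonneg
  have hQ := ((h.tendsto_mul_integral_sq s v).div_const 2).neg
  rw [← neg_div] at hQ
  have hQ' := (Complex.continuous_ofReal.tendsto _).comp hQ
  refine hQ'.congr_dist (squeeze_zero' (.of_forall fun n => dist_nonneg) (g := fun n =>
    32 * |s| ^ 3 * (occupancyParam n (N n) : ℝ) ^ (r + 1) * (√(occupancyScale r n (N n)))⁻¹ +
      112 * |v| ^ 3 * ((occupancyParam n (N n) : ℝ))⁻¹ * (√(occupancySumVar n (N n)))⁻¹) ?_ ?_)
  · filter_upwards [h.tendsto_boxes.eventually_gt_atTop 0, eventually_gt_atTop 0] with n hN hn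
    have hB := occupancyScale_pos r hn hN
    have hV := occupancySumVar_pos hn hN
    have hp0 := occupancyParam_ne_zero (n := n) hN
    have hpp : 0 < (occupancyParam n (N n) : ℝ) := unitInterval.pos_iff_ne_zero.2 hp0
    have e1 := mul_occupancyParam_div_scale r hn hN
    have e2 := mul_occupancyParam_variance (n := n) hN
    have hb := norm_geomCharFun_sub_le hp0 r (s / √(occupancyScale r n (N n)))
      (v / √(occupancySumVar n (N n)))
    set B := occupancyScale r n (N n)
    set V := occupancySumVar n (N n)
    set ψ := geomCharFun (occupancyParam n (N n)) r (s / √B) (v / √V)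
    set I := ∫ k, geomCentred (occupancyParam n (N n)) r (s / √B) (v / √V) k ^ 2
          ∂geometricMeasure (occupancyParam n (N n))
    set p := (occupancyParam n (N n) : ℝ)
    have hsB : √B ^ 2 = B := Real.sq_sqrt hB.le
    have hsV : √V ^ 2 = V := Real.sq_sqrt hV.le
    have hsB0 : 0 < √B := Real.sqrt_pos.2 hB
    have hsV0 : 0 < √V := Real.sqrt_pos.2 hV
    have hNc := mul_le_mul_of_nonneg_left hb (Nat.cast_nonneg (α := ℝ) (N n))
    rw [dist_comm, Complex.dist_eq]
    have hl : (N n : ℂ) * (ψ - 1) - ((-((N n : ℝ) * I / 2) : ℝ) : ℂ) =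
        (N n : ℂ) * (ψ - (1 - (I : ℂ) / 2)) := by
      push_cast
      ring
    change ‖(N n : ℂ) * (ψ - 1) - ((-((N n : ℝ) * I / 2) : ℝ) : ℂ)‖ ≤ _
    rw [hl, norm_mul, Complex.norm_natCast]
    refine hNc.trans (le_of_eq ?_)
    rw [abs_div, abs_div, abs_of_pos hsB0, abs_of_pos hsV0, div_pow, div_pow,
      pow_succ (√B), pow_succ (√V), hsB, hsV]
    calc _ = 32 * |s| ^ 3 * (N n * ((1 - p) ^ r * p)) / B * (√B)⁻¹ +
          112 * |v| ^ 3 * (N n * ((1 - p) / p ^ 2)) / V * p⁻¹ * (√V)⁻¹ := by ring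
      _ = _ := by
        rw [e1, e2]
        field_simp
  · have hB := tendsto_inv_atTop_zero.comp (Real.tendsto_sqrt_atTop.comp h.tendsto_scale)
    have hV := tendsto_inv_atTop_zero.comp (Real.tendsto_sqrt_atTop.comp h.tendsto_sumVar)
    have := (((hp.pow (r + 1)).const_mul (32 * |s| ^ 3)).mul hB).add
      (((hp.inv₀ (by positivity)).const_mul (112 * |v| ^ 3)).mul hV)
    simpa using this

lemma eventually_norm_geomCharFun_pow_le (h : OccupancyRegime r N x β c a) :
    ∀ᶠ n in atTop, ∀ t v : ℝ, |v| ≤ Real.pi * √(occupancySumVar n (N n)) →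
      ‖geomCharFun (occupancyParam n (N n)) r t (v / √(occupancySumVar n (N n))) ^ N n‖ ≤
        Real.exp (-(c * (2 / Real.pi ^ 2) * (1 / (2 + x)) ^ 2) * v ^ 2) := by
  have hx := h.ratio_nonneg
  -- Any positive number below the limit of `p` would serve as an eventual lower bound.
  have hlt : 1 / (2 + x) < 1 / (1 + x) := by gcongr; norm_num
  filter_upwards [h.tendsto_boxes.eventually_gt_atTop 0, eventually_gt_atTop 0,
    h.tendsto_param.eventually_const_le hlt, h.eventually_le] with n hN hn hp hc t v hv
  have hV := occupancySumVar_pos hn hN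
  have hp0 := occupancyParam_ne_zero (n := n) hN
  have hb := norm_geomCharFun_le hp0 h.ne_left h.ne_right t (v / √(occupancySumVar n (N n)))
  have e2 := mul_occupancyParam_variance (n := n) hN
  have hpp : 0 < (occupancyParam n (N n) : ℝ) := unitInterval.pos_iff_ne_zero.2 hp0
  have hq : 0 ≤ 1 - (occupancyParam n (N n) : ℝ) := by
    linarith [(occupancyParam n (N n)).2.2]
  have hc0 := h.pos
  set V := occupancySumVar n (N n)
  set p := (occupancyParam n (N n) : ℝ)
  have hsV0 : 0 < √V := Real.sqrt_pos.2 hV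
  have hu : |v / √V| ≤ Real.pi := by
    rw [abs_div, abs_of_pos hsV0, div_le_iff₀ hsV0]; exact hv
  have hcos := Real.cos_le_one_sub_mul_cos_sq hu
  rw [div_pow, Real.sq_sqrt hV.le] at hcos
  have hcos' : 2 / Real.pi ^ 2 * (v ^ 2 / V) ≤ 1 - Real.cos (v / √V) := by linarith
  have h1 : c * (1 - p) * (2 / Real.pi ^ 2 * (v ^ 2 / V)) ≤
      ((1 - p) ^ a * p) * ((1 - p) ^ (a + 1) * p) * (1 - Real.cos (v / √V)) := by
    gcongr
  have h2 : ‖geomCharFun (occupancyParam n (N n)) r t (v / √V)‖ ≤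
      Real.exp (-(c * (1 - p) * (2 / Real.pi ^ 2 * (v ^ 2 / V)))) := by
    refine hb.trans ?_
    have := Real.add_one_le_exp (-(c * (1 - p) * (2 / Real.pi ^ 2 * (v ^ 2 / V))))
    linarith
  rw [norm_pow]
  refine (pow_le_pow_left₀ (norm_nonneg _) h2 _).trans ?_
  rw [← Real.exp_nat_mul, Real.exp_le_exp]
  -- The factor `1 - p` in the regime's mass bound is what `V` absorbs, leaving a rate bounded
  -- below.
  have e3 : (N n : ℝ) * (1 - p) / V = p ^ 2 := by
    rw [← e2]
    have hN' : (N n : ℝ) ≠ 0 := by positivity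
    have hq' : 1 - p ≠ 0 := by
      rw [one_sub_occupancyParam hN]; positivity
    field_simp
  have e4 : (N n : ℝ) * -(c * (1 - p) * (2 / Real.pi ^ 2 * (v ^ 2 / V))) =
      -(c * (2 / Real.pi ^ 2) * (N n * (1 - p) / V)) * v ^ 2 := by ring
  rw [e4, e3]
  gcongr

/-- After `u = v / √V` the window `[-π √V, π √V]` grows to the whole line and dominated convergence
applies. -/
lemma tendsto_sqrt_mul_integral (h : OccupancyRegime r N x β c a) (s : ℝ) :
    Tendsto (fun n => (√(occupancySumVar n (N n)) : ℂ) * ∫ u in -Real.pi..Real.pi,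
        geomCharFun (occupancyParam n (N n)) r (s / √(occupancyScale r n (N n))) u ^ N n) atTop
      (𝓝 (∫ v : ℝ, Complex.exp ((-((v + s * occupancyShift r x β) ^ 2
        + s ^ 2 * occupancyLimitVar r x β) / 2 : ℝ)))) := by
  have hx := h.ratio_nonneg
  have hsV := Real.tendsto_sqrt_atTop.comp h.tendsto_sumVar
  have hkey : Tendsto (fun n => ∫ v : ℝ,
      (Set.Ioc (-(Real.pi * √(occupancySumVar n (N n)))) (Real.pi * √(occupancySumVar n (N n)))
        ).indicator (fun v => geomCharFun (occupancyParam n (N n)) r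
          (s / √(occupancyScale r n (N n))) (v / √(occupancySumVar n (N n))) ^ N n) v) atTop
      (𝓝 (∫ v : ℝ, Complex.exp ((-((v + s * occupancyShift r x β) ^ 2
        + s ^ 2 * occupancyLimitVar r x β) / 2 : ℝ)))) := by
    have hc0 := h.pos
    refine tendsto_integral_filter_of_dominated_convergence
      (fun v => Real.exp (-(c * (2 / Real.pi ^ 2) * (1 / (2 + x)) ^ 2) * v ^ 2)) ?_ ?_ ?_ ?_
    · refine .of_forall fun n => ?_
      refine (Continuous.aestronglyMeasurable ?_).indicator measurableSet_Ioc
      exact ((continuous_geomCharFun _ _ _).comp (continuous_id.div_const _)).pow _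
    · filter_upwards [h.eventually_norm_geomCharFun_pow_le] with n hn
      refine .of_forall fun v => ?_
      rw [Set.indicator_apply]
      split_ifs with hv
      · exact hn _ v (abs_le.2 ⟨hv.1.le, hv.2⟩)
      · rw [norm_zero]; positivity
    · exact integrable_exp_neg_mul_sq (by positivity)
    · refine .of_forall fun v => ?_
      refine (h.tendsto_geomCharFun_pow s v).congr' ?_
      have hlarge := (hsV.const_mul_atTop Real.pi_pos).eventually_gt_atTop |v|
      filter_upwards [hlarge] with n hn
      rw [Set.indicator_of_mem]
      have := abs_lt.1 hn
      exact ⟨this.1, this.2.le⟩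
  refine hkey.congr' ?_
  filter_upwards [h.tendsto_boxes.eventually_gt_atTop 0, eventually_gt_atTop 0] with n hN hn
  have hsV0 : 0 < √(occupancySumVar n (N n)) := Real.sqrt_pos.2 (occupancySumVar_pos hn hN)
  rw [integral_indicator measurableSet_Ioc, ← intervalIntegral.integral_of_le (by
    have := Real.pi_pos; have := mul_pos this hsV0; linarith),
    intervalIntegral.integral_comp_div (fun u => geomCharFun (occupancyParam n (N n)) r
      (s / √(occupancyScale r n (N n))) u ^ N n) hsV0.ne', neg_div,
    mul_div_cancel_right₀ _ hsV0.ne', Complex.real_smul]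

end OccupancyRegime

lemma integral_cexp_neg_sq_shift (d e : ℝ) :
    ∫ v : ℝ, Complex.exp ((-((v + d) ^ 2 + e) / 2 : ℝ)) =
      (Real.exp (-e / 2) * √(2 * Real.pi) : ℝ) := by
  have h1 : ∀ v : ℝ, Complex.exp ((-((v + d) ^ 2 + e) / 2 : ℝ)) =
      ((Real.exp (-(1 / 2) * (v + d) ^ 2) * Real.exp (-e / 2) : ℝ) : ℂ) := fun v => by
    rw [← Real.exp_add, Complex.ofReal_exp]
    ring_nf
  simp_rw [h1]
  rw [integral_complex_ofReal, integral_mul_const,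
    integral_add_right_eq_self (fun v => Real.exp (-(1 / 2) * v ^ 2)), integral_gaussian, mul_comm,
    show Real.pi / (1 / 2) = 2 * Real.pi by ring]

namespace OccupancyRegime

variable {r : ℕ} {N : ℕ → ℕ} {x β c : ℝ} {a : ℕ}

lemma tendsto_integral_cexp (h : OccupancyRegime r N x β c a) (s : ℝ) :
    Tendsto (fun n => ∫ k, Complex.exp ((s / √(occupancyScale r n (N n)) * (boxesWithExactly r k
        - N n * ((1 - occupancyParam n (N n)) ^ r * occupancyParam n (N n))) : ℝ) * Complex.I)
        ∂indistinguishableBallsLaw n (N n)) atTop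
      (𝓝 (Complex.exp (-(occupancyLimitVar r x β * s ^ 2) / 2 : ℝ))) := by
  have hs := h.tendsto_sqrt_mul_integral s
  have h0 := h.tendsto_sqrt_mul_integral 0
  rw [integral_cexp_neg_sq_shift] at hs h0
  have hpi : √(2 * Real.pi) ≠ 0 := by have := Real.pi_pos; positivity
  have hd := hs.div h0 (by
    simp only [ne_eq, Complex.ofReal_eq_zero, mul_eq_zero, not_or]
    exact ⟨(Real.exp_pos _).ne', hpi⟩)
  have he : ((Real.exp (-(s ^ 2 * occupancyLimitVar r x β) / 2) * √(2 * Real.pi) : ℝ) : ℂ) /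
      ((Real.exp (-(0 ^ 2 * occupancyLimitVar r x β) / 2) * √(2 * Real.pi) : ℝ) : ℂ) =
      Complex.exp (-(occupancyLimitVar r x β * s ^ 2) / 2 : ℝ) := by
    rw [← Complex.ofReal_div, mul_div_mul_right _ _ hpi, ← Complex.ofReal_exp]
    simp [mul_comm]
  rw [he] at hd
  refine hd.congr' ?_
  filter_upwards [h.tendsto_boxes.eventually_gt_atTop 0, eventually_gt_atTop 0] with n hN hn
  have hsV0 : 0 < √(occupancySumVar n (N n)) := Real.sqrt_pos.2 (occupancySumVar_pos hn hN)
  rw [integral_cexp_boxesWithExactly (occupancyParam_ne_zero hN) (occupancyParam_ne_one hn hN)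
    (mul_occupancyParam_odds hN), Pi.div_apply, zero_div,
    mul_div_mul_left _ _ (by exact_mod_cast hsV0.ne')]

/-- The quotient is `p ^ (r + 1) * √(B / n) * (√n * (ρ - 1))`. Here `B / n = (B / V) * (1 + n / N)`
converges and the last factor is `O(1 / √n)`. -/
lemma tendsto_centering (h : OccupancyRegime r N x β c a) :
    Tendsto (fun n => (∫ k, (boxesWithExactly r k : ℝ) ∂indistinguishableBallsLaw n (N n)
        - N n * ((1 - occupancyParam n (N n)) ^ r * occupancyParam n (N n))) /
          √(occupancyScale r n (N n))) atTop (𝓝 0) := by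
  obtain ⟨ρ, hρ, hE⟩ := exists_integral_boxesWithExactly_eq h.tendsto_boxes
    (h.tendsto_ratio.eventually_le_const (lt_add_one x)) r
  have hx := h.ratio_nonneg
  have hρ' : (fun n : ℕ => √(n : ℝ) * (ρ n - 1)) =O[atTop] fun n : ℕ => (√(n : ℝ))⁻¹ := by
    refine ((Asymptotics.isBigO_refl (fun n : ℕ => √(n : ℝ)) atTop).mul hρ).congr'
      EventuallyEq.rfl ?_
    filter_upwards [eventually_gt_atTop 0] with n hn
    have : 0 < √(n : ℝ) := Real.sqrt_pos.2 (by exact_mod_cast hn)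
    have h2 : (n : ℝ) = √(n : ℝ) * √(n : ℝ) := (Real.mul_self_sqrt (by positivity)).symm
    rw [mul_one_div, div_eq_iff (by positivity)]
    nth_rw 3 [h2]
    field_simp
  have h1 : Tendsto (fun n : ℕ => √(n : ℝ) * (ρ n - 1)) atTop (𝓝 0) :=
    hρ'.trans_tendsto (tendsto_inv_atTop_zero.comp
      (Real.tendsto_sqrt_atTop.comp tendsto_natCast_atTop_atTop))
  have h2 := (((h.tendsto_param.pow (r + 1)).mul (h.tendsto_scale_div.mul
    (h.tendsto_ratio.const_add 1)).sqrt)).mul h1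
  rw [mul_zero] at h2
  refine h2.congr' ?_
  filter_upwards [h.tendsto_boxes.eventually_gt_atTop 0, eventually_gt_atTop 0, hE]
    with n hN hn hE
  have hB := occupancyScale_pos r hn hN
  have hN0 : (0 : ℝ) < N n := by exact_mod_cast hN
  have hn0 : (0 : ℝ) < n := by exact_mod_cast hn
  have hsB0 : 0 < √(occupancyScale r n (N n)) := Real.sqrt_pos.2 hB
  have e : occupancyScale r n (N n) / occupancySumVar n (N n) * (1 + n / N n) =
      occupancyScale r n (N n) / n := by
    rw [occupancySumVar]; field_simp
  have hsn : 0 < √(n : ℝ) := Real.sqrt_pos.2 hn0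
  rw [hE, mul_occupancyParam_div_scale r hn hN, e, Real.sqrt_div hB.le]
  have h2 : occupancyScale r n (N n) = √(occupancyScale r n (N n)) ^ 2 :=
    (Real.sq_sqrt hB.le).symm
  rw [eq_div_iff hsB0.ne']
  set b := √(occupancyScale r n (N n))
  rw [h2]
  field_simp

end OccupancyRegime

/-! ### Convergence in distribution -/

namespace OccupancyRegime

variable {r : ℕ} {N : ℕ → ℕ} {x β c : ℝ} {a : ℕ}

/-- Lévy's continuity theorem; passing to the exact mean multiplies the characteristic function by a
phase tending to `1`. -/
lemma tendstoInDistribution (h : OccupancyRegime r N x β c a) (hσ : 0 ≤ occupancyLimitVar r x β)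
    {Ω : ℕ → Type*} [∀ n, MeasurableSpace (Ω n)]
    (P : (n : ℕ) → Measure (Ω n)) [∀ n, IsProbabilityMeasure (P n)]
    (ξ : (n : ℕ) → Ω n → (Fin (N n) → ℕ))
    (hξ : ∀ n, HasLaw (ξ n) (indistinguishableBallsLaw n (N n)) (P n)) :
    TendstoInDistribution
      (fun (n : ℕ) (ω : Ω n) =>
        ((boxesWithExactly r (ξ n ω) : ℝ) - ∫ ω', (boxesWithExactly r (ξ n ω') : ℝ) ∂(P n)) /
          Real.sqrt (occupancyScale r n (N n)))
      atTop (id : ℝ → ℝ) P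
      (gaussianReal 0 (Real.toNNReal (occupancyLimitVar r x β))) := by
  have hmeas (n : ℕ) : AEMeasurable (fun ω => ((boxesWithExactly r (ξ n ω) : ℝ) -
      ∫ ω', (boxesWithExactly r (ξ n ω') : ℝ) ∂(P n)) / √(occupancyScale r n (N n))) (P n) :=
    (Measurable.of_discrete (f := fun k : Fin (N n) → ℕ => ((boxesWithExactly r k : ℝ) -
      ∫ ω', (boxesWithExactly r (ξ n ω') : ℝ) ∂(P n)) / √(occupancyScale r n (N n)))
      ).comp_aemeasurable (hξ n).aemeasurable
  refine ⟨hmeas, aemeasurable_id, ?_⟩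
  refine ProbabilityMeasure.tendsto_iff_tendsto_charFun.2 fun t => ?_
  have hE (n : ℕ) : ∫ ω', (boxesWithExactly r (ξ n ω') : ℝ) ∂(P n) =
      ∫ k, (boxesWithExactly r k : ℝ) ∂indistinguishableBallsLaw n (N n) :=
    (hξ n).integral_comp (f := fun k => (boxesWithExactly r k : ℝ)) (by fun_prop)
  have hlim : charFun (Measure.map id (gaussianReal 0 (occupancyLimitVar r x β).toNNReal)) t =
      Complex.exp (-(occupancyLimitVar r x β * t ^ 2) / 2 : ℝ) * Complex.exp ((0 : ℝ) : ℂ) := by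
    rw [Measure.map_id, charFun_gaussianReal, Real.coe_toNNReal _ hσ]
    simp [neg_div]
  simp only [ProbabilityMeasure.coe_mk]
  rw [hlim]
  have hδ : Tendsto (fun n => Complex.exp (-(t * ((∫ k, (boxesWithExactly r k : ℝ)
      ∂indistinguishableBallsLaw n (N n)
        - N n * ((1 - occupancyParam n (N n)) ^ r * occupancyParam n (N n))) /
          √(occupancyScale r n (N n))) : ℝ) * Complex.I)) atTop (𝓝 (Complex.exp ((0 : ℝ) : ℂ))) := by
    have h1 := (Complex.continuous_ofReal.tendsto _).comp (h.tendsto_centering.const_mul t)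
    have h2 := (Complex.continuous_exp.tendsto _).comp ((h1.neg).mul_const Complex.I)
    simpa [Function.comp_def] using h2
  refine ((h.tendsto_integral_cexp t).mul hδ).congr fun n => ?_
  rw [charFun_apply_real, integral_map (hmeas n) (by fun_prop), hE]
  set e := ∫ k, (boxesWithExactly r k : ℝ) ∂indistinguishableBallsLaw n (N n)
  have hcomp := (hξ n).integral_comp (f := fun k => Complex.exp ((t : ℂ) *
    ((((boxesWithExactly r k : ℝ) - e) / √(occupancyScale r n (N n)) : ℝ) : ℂ) * Complex.I))
    (by fun_prop)
  simp only [Function.comp_def] at hcomp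
  rw [hcomp, ← integral_mul_const]
  congr 1 with k
  rw [← Complex.exp_add]
  push_cast
  ring_nf

end OccupancyRegime

/-! ### The two cases, `n / N → x > 0` and `n / N → 0` -/

section Limits

variable {N : ℕ → ℕ} {lam : ℝ≥0∞}

lemma tendsto_boxes_atTop (hlam : 0 < lam)
    (hN : Tendsto (fun n : ℕ => (N n : ℝ≥0∞) / (n : ℝ≥0∞)) atTop (𝓝 lam)) :
    Tendsto N atTop atTop := by
  obtain ⟨c, hc0, hc⟩ := ENNReal.lt_iff_exists_nnreal_btwn.1 hlam
  have hc0' : 0 < (c : ℝ) := by exact_mod_cast hc0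
  rw [← tendsto_natCast_atTop_iff (R := ℝ)]
  refine tendsto_atTop_mono' _ ?_ (tendsto_natCast_atTop_atTop.const_mul_atTop hc0')
  filter_upwards [hN.eventually_const_lt hc] with n hn
  have := ENNReal.mul_le_of_le_div hn.le
  exact_mod_cast this

/-- Inversion is continuous on `ℝ≥0∞`, so `lam = ∞` is covered, with limit `0`. -/
lemma tendsto_ratio_toReal_inv (hlam : 0 < lam)
    (hN : Tendsto (fun n : ℕ => (N n : ℝ≥0∞) / (n : ℝ≥0∞)) atTop (𝓝 lam)) :
    Tendsto (fun n : ℕ => (n : ℝ) / N n) atTop (𝓝 (lam⁻¹).toReal) := by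
  refine ((ENNReal.tendsto_toReal (ENNReal.inv_ne_top.2 hlam.ne')).comp
    (tendsto_inv_iff.2 hN)).congr fun n => ?_
  simp [ENNReal.toReal_inv, ENNReal.toReal_div]

lemma occupancyScale_div_sumVar {n N : ℕ} (r : ℕ) (hn : 0 < n) (hN : 0 < N) :
    occupancyScale r n N / occupancySumVar n N =
      ((n : ℝ) / N) ^ r / ((n : ℝ) / N * (1 + n / N)) := by
  rw [occupancyScale_eq r hN, occupancySumVar]
  field_simp

lemma occupancyRegime_of_ratio_pos (r : ℕ) {x : ℝ} (hx : 0 < x) (hboxes : Tendsto N atTop atTop)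
    (hratio : Tendsto (fun n : ℕ => (n : ℝ) / N n) atTop (𝓝 x)) :
    ∃ c a, OccupancyRegime r N x (x ^ r / (x * (1 + x))) c a := by
  have hp := tendsto_occupancyParam hx.le hboxes hratio
  have hq : 0 < 1 - 1 / (1 + x) := by
    rw [sub_pos, div_lt_one (by positivity)]; linarith
  have hw := (((hp.const_sub 1).pow (r + 1)).mul hp).mul (((hp.const_sub 1).pow (r + 1 + 1)).mul hp)
  set L := ((1 - 1 / (1 + x)) ^ (r + 1) * (1 / (1 + x))) *
    ((1 - 1 / (1 + x)) ^ (r + 1 + 1) * (1 / (1 + x))) with hL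
  have hL0 : 0 < L := by positivity
  -- The values `r + 1, r + 2` avoid `r`, and the product of their masses tends to `L > 0`.
  refine ⟨L / 2, r + 1, hboxes, hratio, ?_, ?_, by omega, by omega, by positivity, ?_⟩
  · refine ((tendsto_natCast_atTop_atTop.comp hboxes).atTop_mul_pos (pow_pos hx r)
      (hratio.pow r)).congr' ?_
    filter_upwards [hboxes.eventually_gt_atTop 0] with n hn
    exact (occupancyScale_eq r hn).symm
  · refine ((hratio.pow r).div (hratio.mul (hratio.const_add 1)) (by positivity)).congr' ?_
    filter_upwards [hboxes.eventually_gt_atTop 0, eventually_gt_atTop 0] with n hN hn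
    exact (occupancyScale_div_sumVar r hn hN).symm
  · filter_upwards [hw.eventually_const_le (half_lt_self hL0)] with n hn
    refine le_trans ?_ hn
    exact mul_le_of_le_one_right (by positivity) (by linarith [(occupancyParam n (N n)).2.1])

/-- As `r ≥ 2`, the values `0, 1` avoid `r`; the product of their masses is `p ^ 2 * (1 - p)`, and
`1 / 4` comes from `p ≥ 1 / 2`. Here `β = 0`, so conditioning costs no variance in the limit. -/
lemma occupancyRegime_of_ratio_zero {r : ℕ} (hr : 2 ≤ r) (hboxes : Tendsto N atTop atTop)
    (hratio : Tendsto (fun n : ℕ => (n : ℝ) / N n) atTop (𝓝 0))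
    (hscale : Tendsto (fun n : ℕ => occupancyScale r n (N n)) atTop atTop) :
    OccupancyRegime r N 0 0 (1 / 4) 0 := by
  have hp := tendsto_occupancyParam le_rfl hboxes hratio
  refine ⟨hboxes, hratio, hscale, ?_, by omega, by omega, by norm_num, ?_⟩
  · have := (hratio.pow (r - 1)).div (hratio.const_add 1) (by norm_num)
    rw [zero_pow (by omega), zero_div] at this
    refine this.congr' ?_
    filter_upwards [hboxes.eventually_gt_atTop 0, eventually_gt_atTop 0] with n hN hn
    rw [occupancyScale_div_sumVar r hn hN, Pi.div_apply]
    obtain ⟨j, rfl⟩ : ∃ j, r = j + 1 := ⟨r - 1, by omega⟩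
    rw [add_tsub_cancel_right, pow_succ' _ j, mul_div_mul_left _ _ (by positivity)]
  · filter_upwards [hp.eventually_const_le (show (1 / 2 : ℝ) < 1 / (1 + 0) by norm_num)] with n hn
    have hq : 0 ≤ 1 - (occupancyParam n (N n) : ℝ) := by
      linarith [(occupancyParam n (N n)).2.2]
    have h2 : (1 / 4 : ℝ) ≤ (occupancyParam n (N n) : ℝ) ^ 2 := by nlinarith
    simp only [pow_zero, zero_add, pow_one, one_mul]
    nlinarith

/-- With `x = 1 / l`, the shift contributes the `(l * r - 1) ^ 2` term through `r - x = (l * r - 1)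
/ l`. -/
lemma occupancyLimitVar_inv (r : ℕ) {l : ℝ} (hl : 0 < l) :
    occupancyLimitVar r l⁻¹ (l⁻¹ ^ r / (l⁻¹ * (1 + l⁻¹))) = occupancySigmaSqFinite r l := by
  have h1 : 1 / (1 + l⁻¹) = l / (1 + l) := by field_simp; ring
  have h2 : 1 - l / (1 + l) = 1 / (1 + l) := by field_simp; ring
  rw [occupancyLimitVar, occupancyShift, mul_pow, Real.sq_sqrt (by positivity), h1, h2,
    occupancySigmaSqFinite, div_pow, div_pow, one_pow, inv_pow]
  field_simp
  ring

lemma occupancyLimitVar_zero {r : ℕ} (hr : r ≠ 0) : occupancyLimitVar r 0 0 = 1 := by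
  simp [occupancyLimitVar, occupancyShift, hr]

end Limits

theorem mainTheorem4
    (r : ℕ) (N : ℕ → ℕ) (lam : ℝ≥0∞) (hlam : 0 < lam)
    (hN : Tendsto (fun n : ℕ => (N n : ℝ≥0∞) / (n : ℝ≥0∞)) atTop (𝓝 lam))
    (hcase : lam < ∞ ∨
      (2 ≤ r ∧ lam = ∞ ∧ Tendsto (fun n : ℕ => occupancyScale r n (N n)) atTop atTop))
    {Ω : ℕ → Type*} [∀ n, MeasurableSpace (Ω n)]
    (P : (n : ℕ) → Measure (Ω n)) [∀ n, IsProbabilityMeasure (P n)]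
    (ξ : (n : ℕ) → Ω n → (Fin (N n) → ℕ))
    (hξ : ∀ n, HasLaw (ξ n) (indistinguishableBallsLaw n (N n)) (P n)) :
    TendstoInDistribution
      (fun (n : ℕ) (ω : Ω n) =>
        ((boxesWithExactly r (ξ n ω) : ℝ) - ∫ ω', (boxesWithExactly r (ξ n ω') : ℝ) ∂(P n)) /
          Real.sqrt (occupancyScale r n (N n)))
      atTop (id : ℝ → ℝ) P
      (gaussianReal 0 (Real.toNNReal (occupancySigmaSq r lam))) := by
  have hboxes := tendsto_boxes_atTop hlam hN
  have hratio := tendsto_ratio_toReal_inv hlam hN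
  -- Ensures that `Real.toNNReal` does not truncate the variance.
  have hσ := occupancySigmaSq_pos r hlam
  by_cases htop : lam = ∞
  · rcases hcase with h | ⟨hr, -, hscale⟩
    · exact absurd htop h.ne
    · rw [htop, ENNReal.inv_top, ENNReal.toReal_zero] at hratio
      have hv : occupancySigmaSq r lam = occupancyLimitVar r 0 0 := by
        rw [occupancySigmaSq, if_pos htop, occupancyLimitVar_zero (by omega)]
      rw [hv] at hσ ⊢
      exact (occupancyRegime_of_ratio_zero hr hboxes hratio hscale).tendstoInDistribution hσ.le P ξ
        hξ
  · have hl : 0 < lam.toReal := ENNReal.toReal_pos hlam.ne' htop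
    rw [ENNReal.toReal_inv] at hratio
    obtain ⟨c, a, h⟩ := occupancyRegime_of_ratio_pos r (inv_pos.2 hl) hboxes hratio
    have hv := occupancyLimitVar_inv r hl
    rw [occupancySigmaSq, if_neg htop, ← hv] at hσ ⊢
    exact h.tendstoInDistribution hσ.le P ξ hξ
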